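/- Let $M\subseteq B(H)$ be a von Neumann algebra on a complex Hilbert space $H$, let $M^+$ be its cone of positive elements and $M^{sa}$ its self-adjoint part. Let $M_*$ be the predual of $M$, that is, the space of $\sigma$-weakly continuous linear functionals on $M$ with the norm of the Banach dual $M^*$, let $M_*^{sa}$ be the space of those $\omega\in M_*$ with $\omega(x^*)=\overline{\omega(x)}$ for all $x\in M$, and let $M_*^+$ be the set of those $\omega\in M_*$ with $\omega(x)\ge 0$ for all $x\in M^+$, with the corresponding order on $M_*^{sa}$. Let $F_*$ be a non-empty norm-closed convex subset of $M_*^+$ that is hereditary: if $\varphi,\psi\in M_*$, $0\le\varphi\le\psi$ and $\psi\in F_*$, then $\varphi\in F_*$. For $F\subseteq M_*^{sa}$ and $S\subseteq M^{sa}$ define the positive polars $$F^{r+}=\{x\in M^+:\ \omega(x)\le 1\text{ for all }\omega\in F\},\qquad S^{r+}=\{\omega\in M_*^+:\ \omega(x)\le 1\text{ for all }x\in S\}.$$ Then $F_*=F_*^{r+r+}$. Equivalently, for every $\omega'\in M_*^+\setminus F_*$ there is $x\in M^+$ such that $\omega'(x)>1$ and $\omega(x)\le 1$ for all $\omega\in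 F_*$. -/

import Mathlib

namespace VonNeumannAlgebra

open scoped ComplexOrder Topology

variable {H : Type*} [NormedAddCommGroup H] [InnerProductSpace ℂ H] [CompleteSpace H]

/-- The `σ`-weak topology of a von Neumann algebra `M` on `H`: the weakest topology that makes all
the functionals `x ↦ ∑ₙ ⟪ξₙ, x ηₙ⟫` continuous, where `(ξₙ)` and `(ηₙ)` are square-summable
sequences of vectors. -/
noncomputable abbrev sigmaWeakTopology (M : VonNeumannAlgebra H) :
    TopologicalSpace M.toStarSubalgebra :=
  ⨅ (ξ : ℕ → H) (η : ℕ → H)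
    (_ : Summable fun n => ‖ξ n‖ ^ 2) (_ : Summable fun n => ‖η n‖ ^ 2),
    TopologicalSpace.induced
      (fun x : M.toStarSubalgebra => ∑' n, inner ℂ (ξ n) ((x : H →L[ℂ] H) (η n)))
      inferInstance

/-- The predual `M_*`: the space of `σ`-weakly continuous linear functionals on `M`, with the norm
that it inherits from the Banach dual `M^*`. -/
noncomputable def predual (M : VonNeumannAlgebra H) :
    Submodule ℂ (StrongDual ℂ M.toStarSubalgebra) where
  carrier := {ω | Continuous[M.sigmaWeakTopology, inferInstance] fun x => ω x}
  zero_mem' := @continuous_const _ _ M.sigmaWeakTopology _ 0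
  add_mem' := fun ha hb => @Continuous.add _ _ _ _ _ M.sigmaWeakTopology _ _ ha hb
  smul_mem' := fun c a ha =>
    @Continuous.comp _ _ _ M.sigmaWeakTopology _ _ (fun x => a x) (fun z : ℂ => c * z)
      (continuous_const_mul c) ha

/-- The positive cone `M^+`. -/
def positiveCone (M : VonNeumannAlgebra H) : Set M.toStarSubalgebra :=
  {x | (x : H →L[ℂ] H).IsPositive}

/-- The self-adjoint part `M_*^{sa}` of the predual. -/
def predualSelfAdjoint (M : VonNeumannAlgebra H) : Set M.predual :=
  {ω | ∀ x : M.toStarSubalgebra, ω.1 (star x) = star (ω.1 x)}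

/-- The positive cone `M_*^+` of the predual; here `0 ≤ z` in `ℂ` says that `z` is a nonnegative
real number. -/
def predualPositiveCone (M : VonNeumannAlgebra H) : Set M.predual :=
  {ω | ∀ x ∈ M.positiveCone, 0 ≤ ω.1 x}

/-- A subset of `M_*^+` is hereditary if `0 ≤ φ ≤ ψ` and `ψ ∈ F` imply `φ ∈ F`. -/
def IsHereditaryInPredual (M : VonNeumannAlgebra H) (F : Set M.predual) : Prop :=
  F ⊆ M.predualPositiveCone ∧
    ∀ φ ψ : M.predual, φ ∈ M.predualPositiveCone → ψ - φ ∈ M.predualPositiveCone →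
      ψ ∈ F → φ ∈ F

/-- The real polar in `M^{sa}` of a subset of `M_*^{sa}`, for the dual pair `(M_*^{sa}, M^{sa})`.
The pairing of self-adjoint elements is real. -/
def realPolar (M : VonNeumannAlgebra H) (F : Set M.predual) : Set M.toStarSubalgebra :=
  {x | IsSelfAdjoint x ∧ ∀ ω ∈ F, (ω.1 x).re ≤ 1}

/-- The real polar in `M_*^{sa}` of a subset of `M^{sa}`, for the same dual pair. -/
def predualRealPolar (M : VonNeumannAlgebra H) (S : Set M.toStarSubalgebra) : Set M.predual :=
  {ω | ω ∈ M.predualSelfAdjoint ∧ ∀ x ∈ S, (ω.1 x).re ≤ 1}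

/-- The positive polar `F^{r+}` in `M^+` of a subset of `M_*^{sa}`. -/
def positivePolar (M : VonNeumannAlgebra H) (F : Set M.predual) : Set M.toStarSubalgebra :=
  M.realPolar F ∩ M.positiveCone

/-- The positive polar `S^{r+}` in `M_*^+` of a subset of `M^{sa}`. -/
def predualPositivePolar (M : VonNeumannAlgebra H) (S : Set M.toStarSubalgebra) :
    Set M.predual :=
  M.predualRealPolar S ∩ M.predualPositiveCone

end VonNeumannAlgebra

/-! Enlarge `F` to `D_δ` (`dominatedSet`), the functionals below some `a + b` with `a ∈ F`, `b ≥ 0`,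
`b(1) ≤ δ`. It is convex, absorbing and closed downwards, so Hahn-Banach separates any point outside
it by a real functional `f ≤ 1` on `D_δ`. Downward closure makes `f` monotone, the room `δ` gives
`f(b) ≤ b(1)/δ` for `b ≥ 0`, and the bicommutant theorem turns such an `f` into the real part of
evaluation at a positive `x ∈ M` (`exists_mem_positiveCone_eq_re`).

It remains that a positive `φ ∉ F` misses some `D_δ`; here closedness and heredity enter, through
`exists_le_norm_sub_le`. If `φ ≤ a + b`, write `a = ω_ξ`, `b = ω_η` with vectors of `ℓ²(ℕ, H)`, so
that `a + b = ω_{ξ⊕η}`. By Radon-Nikodym, `φ = ω_{r(ξ⊕η)}` with `r = √h` and `0 ≤ h ≤ 1` in the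
commutant. Then `ψ = ω_{r(ξ⊕0)} ≤ a` lies in `F`, and `‖φ - ψ‖` is bounded in terms of `φ(1)` and
`δ` alone. If this happened for every `δ`, `φ` would lie in the closure of `F`. -/

namespace VonNeumannAlgebra

open scoped ComplexOrder Topology InnerProductSpace

/-! ### Radon-Nikodym densities in the commutant. -/

section RadonNikodym

variable {A K : Type*} [NormedAddCommGroup K] [InnerProductSpace ℂ K]

/-- A linear map with dense range determines vectors by their inner products. -/
theorem eq_of_inner_eq_of_denseRange [AddCommGroup A] [Module ℂ A] {e : A →ₗ[ℂ] K}
    (he : DenseRange e) {u v : K} (h : ∀ x, ⟪u, e x⟫_ℂ = ⟪v, e x⟫_ℂ) : u = v := by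
  refine ext_inner_right ℂ fun w => ?_
  exact he.induction_on (p := fun w => ⟪u, w⟫_ℂ = ⟪v, w⟫_ℂ) w
    (isClosed_eq (by fun_prop) (by fun_prop)) h

variable [Ring A] [StarRing A] [Algebra ℂ A]

/-- The Cauchy-Schwarz inequality for a positive hermitian functional. -/
theorem norm_apply_star_mul_sq_le [StarModule ℂ A] {φ : A →ₗ[ℂ] ℂ}
    (hpos : ∀ x, 0 ≤ φ (star x * x)) (hsa : ∀ x, φ (star x) = star (φ x)) (x y : A) :
    ‖φ (star y * x)‖ ^ 2 ≤ (φ (star y * y)).re * (φ (star x * x)).re := by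
  let c : PreInnerProductSpace.Core ℂ A :=
    { inner := fun x y => φ (star x * y)
      conj_inner_symm := fun x y => by
        change star (φ (star y * x)) = φ (star x * y)
        rw [← hsa, star_mul, star_star]
      re_inner_nonneg := fun x => (Complex.le_def.1 (hpos x)).1
      add_left := fun x y z => by
        change φ (star (x + y) * z) = φ (star x * z) + φ (star y * z)
        rw [star_add, add_mul, map_add]
      smul_left := fun x y r => by
        change φ (star (r • x) * y) = star r * φ (star x * y)
        rw [star_smul, smul_mul_assoc, map_smul, smul_eq_mul] }
  have h : ‖φ (star y * x)‖ * ‖φ (star x * y)‖ ≤ (φ (star y * y)).re * (φ (star x * x)).re :=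
    @InnerProductSpace.Core.inner_mul_inner_self_le ℂ A _ _ _ c y x
  have h' : φ (star x * y) = star (φ (star y * x)) := by
    rw [← hsa, star_mul, star_star]
  rwa [h', norm_star, ← sq] at h

variable [CompleteSpace K]

/-- A positive functional dominated by the square of a seminorm `‖e ·‖` coming from a linear map
`e` with dense range in a Hilbert space is implemented by a positive contraction. -/
theorem exists_contraction_of_le_norm_sq [StarModule ℂ A] {e : A →ₗ[ℂ] K} (he : DenseRange e)
    {φ : A →ₗ[ℂ] ℂ} (hpos : ∀ x, 0 ≤ φ (star x * x)) (hsa : ∀ x, φ (star x) = star (φ x))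
    (hle : ∀ x, (φ (star x * x)).re ≤ ‖e x‖ ^ 2) :
    ∃ h : K →L[ℂ] K, h.IsPositive ∧ ‖h‖ ≤ 1 ∧ ∀ x y, ⟪h (e y), e x⟫_ℂ = φ (star y * x) := by
  have hb : ∀ y x, ‖φ (star y * x)‖ ≤ ‖e y‖ * ‖e x‖ := fun y x => by
    refine abs_le_of_sq_le_sq' ?_ (by positivity) |>.2
    rw [mul_pow]
    refine (norm_apply_star_mul_sq_le hpos hsa x y).trans
      (mul_le_mul (hle y) (hle x) (Complex.le_def.1 (hpos x)).1 (by positivity))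
  let φ' : A → A →ₗ[ℂ] ℂ := fun y => φ ∘ₗ LinearMap.mulLeft ℂ (star y)
  have hφ' : ∀ y x, φ' y x = φ (star y * x) := fun _ _ => rfl
  -- Riesz vector of `e x ↦ φ (star y * x)`. It is conjugate-linear in `φ' y`, which is
  -- conjugate-linear in `y`, so `S` is linear.
  let S : A → K := fun y => (InnerProductSpace.toDual ℂ K).symm ((φ' y).extendOfNorm e)
  have hS : ∀ y x, ⟪S y, e x⟫_ℂ = φ (star y * x) := fun y x => by
    rw [InnerProductSpace.toDual_symm_apply, LinearMap.extendOfNorm_eq he ⟨‖e y‖, hb y⟩, hφ']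
  have hSn : ∀ y, ‖S y‖ ≤ 1 * ‖e y‖ := fun y => by
    rw [LinearIsometryEquiv.norm_map, one_mul]
    exact LinearMap.opNorm_extendOfNorm_le he (norm_nonneg _) (hb y)
  let S' : A →ₗ[ℂ] K :=
    { toFun := S
      map_add' := fun y z => eq_of_inner_eq_of_denseRange he fun x => by
        rw [inner_add_left, hS, hS, hS, star_add, add_mul, map_add]
      map_smul' := fun c y => eq_of_inner_eq_of_denseRange he fun x => by
        rw [RingHom.id_apply, inner_smul_left, hS, hS, star_smul, smul_mul_assoc, map_smul]
        rfl }
  let h := S'.extendOfNorm e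
  have hh : ∀ y, h (e y) = S y := fun y => LinearMap.extendOfNorm_eq he ⟨1, hSn⟩ y
  refine ⟨h, ?_, LinearMap.opNorm_extendOfNorm_le he zero_le_one hSn, fun x y => by rw [hh, hS]⟩
  rw [ContinuousLinearMap.isPositive_iff_complex]
  intro v
  suffices 0 ≤ ⟪h v, v⟫_ℂ by
    obtain ⟨h1, h2⟩ := Complex.le_def.1 this
    exact ⟨Complex.ext rfl h2, h1⟩
  refine he.induction_on (p := fun v => 0 ≤ ⟪h v, v⟫_ℂ) v
    (isClosed_le continuous_const (by fun_prop)) fun x => ?_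
  rw [hh, hS]
  exact hpos x

/-- A Radon-Nikodym theorem in the commutant: a positive functional dominated by a vector
functional of a representation is given by a positive contraction in the commutant. -/
theorem exists_commutant_density [StarModule ℂ A] (π : A →⋆ₐ[ℂ] (K →L[ℂ] K)) (ξ : K)
    {φ : A →ₗ[ℂ] ℂ} (hpos : ∀ x, 0 ≤ φ (star x * x)) (hsa : ∀ x, φ (star x) = star (φ x))
    (hle : ∀ x, (φ (star x * x)).re ≤ ‖π x ξ‖ ^ 2) :
    ∃ h : K →L[ℂ] K, 0 ≤ h ∧ h ≤ 1 ∧ (∀ x, Commute h (π x)) ∧ ∀ x, φ x = ⟪ξ, π x (h ξ)⟫_ℂ := by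
  have hπ : ∀ x u v, ⟪π x u, v⟫_ℂ = ⟪u, π (star x) v⟫_ℂ := fun x u v => by
    rw [map_star, ContinuousLinearMap.star_eq_adjoint, ContinuousLinearMap.adjoint_inner_right]
  let E : A →ₗ[ℂ] K := (ContinuousLinearMap.apply ℂ K ξ).toLinearMap ∘ₗ π.toAlgHom.toLinearMap
  have hE : ∀ x, E x = π x ξ := fun x => rfl
  -- The density is built on the cyclic subspace generated by `ξ` and extended by zero to its
  -- orthogonal complement.
  let K₀ := (LinearMap.range E).topologicalClosure
  have hmem : ∀ x, E x ∈ K₀ := fun x =>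
    Submodule.le_topologicalClosure _ (LinearMap.mem_range_self E x)
  have : CompleteSpace K₀ := (Submodule.isClosed_topologicalClosure _).completeSpace_coe
  have hdense : ∀ {p : K → Prop}, IsClosed {u | p u} → (∀ x, p (E x)) → ∀ u ∈ K₀, p u := by
    intro p hp h u hu
    exact closure_minimal (t := {u | p u}) (by rintro _ ⟨x, rfl⟩; exact h x) hp hu
  have hinv : ∀ m, ∀ u ∈ K₀, π m u ∈ K₀ := fun m => by
    refine hdense ((Submodule.isClosed_topologicalClosure _).preimage (π m).continuous) fun x => ?_
    rw [hE, ← mul_apply_eq_comp, ← map_mul, ← hE]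
    exact hmem _
  let e : A →ₗ[ℂ] K₀ := E.codRestrict K₀ hmem
  have hee : ∀ x, (e x : K) = π x ξ := fun x => rfl
  have he : DenseRange e := by
    intro u
    rw [closure_subtype]
    refine closure_mono ?_ u.2
    rintro _ ⟨x, rfl⟩
    exact ⟨e x, ⟨x, rfl⟩, rfl⟩
  obtain ⟨h₀, hp, hn, hin⟩ := exists_contraction_of_le_norm_sq he hpos hsa hle
  let P := K₀.orthogonalProjectionOnto
  let h : K →L[ℂ] K := K₀.subtypeL ∘L h₀ ∘L P
  have hh : ∀ v, h v = h₀ (P v) := fun v => rfl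
  have hP : ∀ (u : K₀) (v : K), ⟪u, P v⟫_ℂ = ⟪(u : K), v⟫_ℂ := fun u v =>
    Submodule.inner_orthogonalProjectionOnto_eq_of_mem_left u v
  -- The projection commutes with `π m` because `K₀` is invariant under `π (star m)` too.
  have hPm : ∀ m v, P (π m v) = ⟨π m (P v), hinv m _ (P v).2⟩ := fun m v => by
    refine ext_inner_left ℂ fun u => ?_
    have h1 : ⟪(u : K), π m v⟫_ℂ = ⟪π (star m) u, v⟫_ℂ := by rw [hπ, star_star]
    have h2 : ⟪(u : K), π m (P v)⟫_ℂ = ⟪π (star m) u, P v⟫_ℂ := by rw [hπ, star_star]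
    rw [hP, h1, Submodule.coe_inner, h2]
    exact (hP ⟨_, hinv (star m) u u.2⟩ v).symm
  -- On the dense range of `e`, both sides pair with `e x` to `φ (star y * star m * x)`.
  have hcomm : ∀ m (u : K₀), (h₀ ⟨π m u, hinv m _ u.2⟩ : K) = π m (h₀ u) := fun m u => by
    refine he.induction_on (p := fun u : K₀ => (h₀ ⟨π m u, hinv m _ u.2⟩ : K) = π m (h₀ u)) u
      (isClosed_eq (by fun_prop) (by fun_prop)) fun y => ?_
    have h1 : (⟨π m (e y), hinv m _ (e y).2⟩ : K₀) = e (m * y) := by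
      ext
      simp [hee]
    rw [h1]
    suffices h₀ (e (m * y)) = ⟨π m (h₀ (e y)), hinv m _ (h₀ (e y)).2⟩ from
      congrArg Subtype.val this
    refine eq_of_inner_eq_of_denseRange he fun x => ?_
    rw [hin, Submodule.coe_inner]
    have h2 : ⟪π m (h₀ (e y)), (e x : K)⟫_ℂ = ⟪h₀ (e y), e (star m * x)⟫_ℂ := by
      rw [hπ, Submodule.coe_inner, hee, hee, map_mul, mul_apply_eq_comp]
    rw [h2, hin, star_mul, mul_assoc]
  have hpos' : 0 ≤ h := by
    rw [ContinuousLinearMap.nonneg_iff_isPositive, ContinuousLinearMap.isPositive_iff_complex]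
    intro v
    have h1 : ⟪h v, v⟫_ℂ = ⟪h₀ (P v), P v⟫_ℂ := (hP _ _).symm
    rw [h1]
    exact (ContinuousLinearMap.isPositive_iff_complex _).1 hp _
  refine ⟨h, hpos', ?_, fun m => ?_, fun x => ?_⟩
  · refine (CStarAlgebra.norm_le_one_iff_of_nonneg h hpos').1 (h.opNorm_le_bound zero_le_one ?_)
    intro v
    rw [hh, one_mul]
    calc ‖h₀ (P v)‖ ≤ 1 * ‖P v‖ := h₀.le_of_opNorm_le hn _
      _ ≤ ‖v‖ := by rw [one_mul]; exact Submodule.norm_orthogonalProjectionOnto_apply_le _ _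
  · ext v
    rw [mul_apply_eq_comp, mul_apply_eq_comp, hh, hh, hPm, hcomm]
  · have h1 : P ξ = e 1 := by
      have : ξ = (e 1 : K) := by simp [hee]
      rw [this]
      exact Submodule.orthogonalProjectionOnto_mem_subspace_eq_self _
    have h2 : ⟪ξ, π x (h ξ)⟫_ℂ = ⟪(e (star x) : K), h₀ (e 1)⟫_ℂ := by
      rw [hee, hπ, star_star, hh, h1]
    rw [h2, ← Submodule.coe_inner, ← inner_conj_symm, hin, star_one, one_mul, hsa]
    exact (star_star _).symm

/-- A positive contraction has a self-adjoint contractive square root in its bicommutant. -/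
theorem exists_sqrt_of_contraction {h : K →L[ℂ] K} (h0 : 0 ≤ h) (h1 : h ≤ 1) :
    ∃ r : K →L[ℂ] K, ‖r‖ ≤ 1 ∧ (∀ T, Commute h T → Commute r T) ∧
      ∀ u v, ⟪u, h v⟫_ℂ = ⟪r u, r v⟫_ℂ := by
  refine ⟨CFC.sqrt h, ?_, fun T hT => hT.cfcₙ_nnreal _, fun u v => ?_⟩
  · refine (CStarAlgebra.norm_le_one_iff_of_nonneg _ (CFC.sqrt_nonneg h)).2 ?_
    rw [← CFC.sqrt_one (A := K →L[ℂ] K)]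
    exact CFC.sqrt_le_sqrt h 1 h1
  · have hs : IsSelfAdjoint (CFC.sqrt h) := (CFC.sqrt_nonneg h).isSelfAdjoint
    conv_lhs => rw [← CFC.sqrt_mul_sqrt_self h h0]
    rw [mul_apply_eq_comp, ← ContinuousLinearMap.adjoint_inner_left,
      ← ContinuousLinearMap.star_eq_adjoint, hs.star_eq]

/-- The complement of a positive contraction is a positive contraction with the same commutant. -/
theorem exists_compl_of_contraction {h : K →L[ℂ] K} (h0 : 0 ≤ h) (h1 : h ≤ 1) :
    ∃ h' : K →L[ℂ] K, 0 ≤ h' ∧ h' ≤ 1 ∧ (∀ T, Commute h T → Commute h' T) ∧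
      ∀ v, h' v = v - h v :=
  ⟨1 - h, sub_nonneg.2 h1, sub_le_self 1 h0, fun T hT => (Commute.one_left T).sub_left hT,
    fun _ => rfl⟩

end RadonNikodym

/-! ### The diagonal representation on `ℓ²(ℕ, H)`. -/

section Amplification

variable {H : Type*} [NormedAddCommGroup H]

/-- The space `ℓ²(ℕ, H)` of square-summable sequences of vectors. -/
abbrev SquareSummable (H : Type*) [NormedAddCommGroup H] := lp (fun _ : ℕ => H) 2

theorem summable_norm_sq (ξ : SquareSummable H) : Summable fun n => ‖ξ n‖ ^ 2 := by
  simpa using (lp.memℓp ξ).summable (by norm_num)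

/-- A square-summable sequence as an element of `ℓ²(ℕ, H)`. -/
def squareSummableMk (ξ : ℕ → H) (hξ : Summable fun n => ‖ξ n‖ ^ 2) : SquareSummable H :=
  ⟨ξ, memℓp_gen (by simpa using hξ)⟩

variable [InnerProductSpace ℂ H]

theorem norm_apply_le_norm_smul (x : H →L[ℂ] H) (ξ : SquareSummable H) (n : ℕ) :
    ‖x (ξ n)‖ ≤ ‖((‖x‖ : ℂ) • ξ) n‖ := by
  rw [lp.coeFn_smul, Pi.smul_apply, norm_smul, Complex.norm_real, norm_norm]
  exact x.le_opNorm (ξ n)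

theorem memℓp_comp_apply (x : H →L[ℂ] H) (ξ : SquareSummable H) :
    Memℓp (fun n => x (ξ n)) 2 :=
  Memℓp.mono' (lp.memℓp ((‖x‖ : ℂ) • ξ)) (norm_apply_le_norm_smul x ξ)

/-- The diagonal action of a bounded operator on `ℓ²(ℕ, H)`. -/
noncomputable def amplify (x : H →L[ℂ] H) : SquareSummable H →L[ℂ] SquareSummable H :=
  LinearMap.mkContinuous
    { toFun := fun ξ => ⟨fun n => x (ξ n), memℓp_comp_apply x ξ⟩
      map_add' := fun ξ η => by ext n; exact map_add x _ _
      map_smul' := fun c ξ => by ext n; simp } ‖x‖ fun ξ => by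
    have h : ‖(‖x‖ : ℂ) • ξ‖ = ‖x‖ * ‖ξ‖ := by
      rw [norm_smul, Complex.norm_real, norm_norm]
    rw [← h]
    exact lp.norm_mono (by norm_num) (norm_apply_le_norm_smul x ξ)

@[simp]
theorem amplify_apply (x : H →L[ℂ] H) (ξ : SquareSummable H) (n : ℕ) :
    amplify x ξ n = x (ξ n) := rfl

variable [CompleteSpace H]

variable (H) in
/-- The diagonal representation of the bounded operators on `ℓ²(ℕ, H)`. -/
noncomputable def amplification :
    (H →L[ℂ] H) →⋆ₐ[ℂ] (SquareSummable H →L[ℂ] SquareSummable H) where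
  toFun := amplify
  map_one' := by ext; simp
  map_mul' x y := by ext; simp
  map_zero' := by ext; simp
  map_add' x y := by ext; simp
  commutes' c := by ext; simp [Algebra.algebraMap_eq_smul_one]
  map_star' x := by
    rw [ContinuousLinearMap.star_eq_adjoint, ContinuousLinearMap.star_eq_adjoint,
      ContinuousLinearMap.eq_adjoint_iff]
    intro ξ η
    rw [lp.inner_eq_tsum, lp.inner_eq_tsum]
    simp [ContinuousLinearMap.adjoint_inner_left]

@[simp]
theorem amplification_apply (x : H →L[ℂ] H) (ξ : SquareSummable H) (n : ℕ) :
    amplification H x ξ n = x (ξ n) := rfl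

end Amplification

/-! ### Direct sums of two sequences inside `ℓ²(ℕ, H)`. -/

section Interleave

variable {H : Type*} [NormedAddCommGroup H]

theorem hasSum_interleave {α : Type*} [AddCommMonoid α] [TopologicalSpace α] [ContinuousAdd α]
    {f g : ℕ → α} {a b : α} (hf : HasSum f a) (hg : HasSum g b) :
    HasSum (fun n => Sum.elim f g (Equiv.natSumNatEquivNat.symm n)) (a + b) :=
  (Equiv.hasSum_iff Equiv.natSumNatEquivNat.symm).2 (HasSum.sum hf hg)

/-- The element of `ℓ²(ℕ, H)` with even terms `ξ` and odd terms `η`. -/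
def interleave (ξ η : SquareSummable H) : SquareSummable H :=
  squareSummableMk (fun n => Sum.elim ξ η (Equiv.natSumNatEquivNat.symm n)) <| by
    refine (hasSum_interleave (summable_norm_sq ξ).hasSum
      (summable_norm_sq η).hasSum).summable.congr fun n => ?_
    rcases Equiv.natSumNatEquivNat.symm n with k | k <;> rfl

theorem interleave_apply (ξ η : SquareSummable H) (n : ℕ) :
    interleave ξ η n = Sum.elim ξ η (Equiv.natSumNatEquivNat.symm n) := rfl

theorem interleave_sub (ξ η ξ' η' : SquareSummable H) :
    interleave ξ η - interleave ξ' η' = interleave (ξ - ξ') (η - η') := by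
  ext n
  rw [lp.coeFn_sub, Pi.sub_apply, interleave_apply, interleave_apply, interleave_apply]
  rcases Equiv.natSumNatEquivNat.symm n with k | k <;> rfl

variable [InnerProductSpace ℂ H]

theorem inner_interleave (ξ η ξ' η' : SquareSummable H) :
    ⟪interleave ξ η, interleave ξ' η'⟫_ℂ = ⟪ξ, ξ'⟫_ℂ + ⟪η, η'⟫_ℂ := by
  rw [lp.inner_eq_tsum]
  refine HasSum.tsum_eq ?_
  convert! hasSum_interleave (lp.hasSum_inner (𝕜 := ℂ) ξ ξ') (lp.hasSum_inner (𝕜 := ℂ) η η')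
    using 2 with n
  rw [interleave_apply, interleave_apply]
  rcases Equiv.natSumNatEquivNat.symm n with k | k <;> rfl

theorem norm_interleave_sq (ξ η : SquareSummable H) :
    ‖interleave ξ η‖ ^ 2 = ‖ξ‖ ^ 2 + ‖η‖ ^ 2 := by
  have h := congrArg Complex.re (inner_interleave ξ η ξ η)
  rw [Complex.add_re] at h
  rwa [← inner_self_eq_norm_sq (𝕜 := ℂ), ← inner_self_eq_norm_sq (𝕜 := ℂ) ξ,
    ← inner_self_eq_norm_sq (𝕜 := ℂ) η]

theorem amplification_interleave [CompleteSpace H] (x : H →L[ℂ] H) (ξ η : SquareSummable H) :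
    amplification H x (interleave ξ η) =
      interleave (amplification H x ξ) (amplification H x η) := by
  ext n
  rw [amplification_apply, interleave_apply, interleave_apply]
  rcases Equiv.natSumNatEquivNat.symm n with k | k <;> simp

end Interleave

/-! ### Normal functionals as vector functionals of the amplification. -/

variable {H : Type*} [NormedAddCommGroup H] [InnerProductSpace ℂ H] [CompleteSpace H]
  (M : VonNeumannAlgebra H)

theorem amplification_nonneg {x : H →L[ℂ] H} (hx : x.IsPositive) : 0 ≤ amplification H x :=
  map_nonneg (amplification H) ((ContinuousLinearMap.nonneg_iff_isPositive x).2 hx)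

theorem norm_amplification_le (x : H →L[ℂ] H) : ‖amplification H x‖ ≤ ‖x‖ :=
  NonUnitalStarAlgHom.norm_apply_le (amplification H) x

theorem norm_inner_amplification_le (ξ η : SquareSummable H) (x : H →L[ℂ] H) :
    ‖⟪ξ, amplification H x η⟫_ℂ‖ ≤ ‖ξ‖ * ‖η‖ * ‖x‖ := by
  refine (norm_inner_le_norm ξ _).trans ?_
  rw [mul_assoc, mul_comm ‖η‖]
  exact mul_le_mul_of_nonneg_left
    (ContinuousLinearMap.le_of_opNorm_le _ (norm_amplification_le x) η) (norm_nonneg _)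

/-- The functional `x ↦ ∑ₙ ⟪ξₙ, x ηₙ⟫` on `M`. -/
noncomputable def vectorFunctional (ξ η : SquareSummable H) : M.predual :=
  ⟨LinearMap.mkContinuous
    { toFun := fun x : M.toStarSubalgebra => ⟪ξ, amplification H x η⟫_ℂ
      map_add' := fun x y => by simp
      map_smul' := fun c x => by simp } (‖ξ‖ * ‖η‖) fun x =>
      norm_inner_amplification_le ξ η x, by
    refine continuous_iInf_dom (i := ξ) <| continuous_iInf_dom (i := η) <|
      continuous_iInf_dom (i := summable_norm_sq ξ) <|
      continuous_iInf_dom (i := summable_norm_sq η) ?_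
    convert! continuous_induced_dom using 2⟩

variable {M}

@[simp]
theorem vectorFunctional_apply (ξ η : SquareSummable H) (x : M.toStarSubalgebra) :
    (M.vectorFunctional ξ η).1 x = ⟪ξ, amplification H x η⟫_ℂ := rfl

theorem predual_ext {φ ψ : M.predual} (h : ∀ x, φ.1 x = ψ.1 x) : φ = ψ :=
  Subtype.ext (ContinuousLinearMap.ext h)

theorem vectorFunctional_mem_predualPositiveCone (ξ : SquareSummable H) :
    M.vectorFunctional ξ ξ ∈ M.predualPositiveCone := fun _ hx =>
  ((ContinuousLinearMap.nonneg_iff_isPositive _).1 (amplification_nonneg hx)).inner_nonneg_right ξ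

/-- Every normal functional is of the form `x ↦ ∑ₙ ⟪ξₙ, x ηₙ⟫`. -/
theorem exists_eq_vectorFunctional (ω : M.predual) :
    ∃ ξ η : SquareSummable H, ω = M.vectorFunctional ξ η := by
  let f : SquareSummable H × SquareSummable H → M.toStarSubalgebra →ₗ[ℂ] ℂ :=
    fun p => (M.vectorFunctional p.1 p.2).1.toLinearMap
  -- A functional continuous for the weak topology of a family lies in the linear span of the
  -- family. Interleaving then collapses a finite sum to one term.
  have hspan : ω.1.toLinearMap ∈ Submodule.span ℂ (Set.range f) := by
    rw [LinearMap.mem_span_iff_continuous]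
    have h := ω.2
    change Continuous[M.sigmaWeakTopology, inferInstance] _ at h
    refine continuous_le_dom ?_ h
    refine le_iInf fun ξ => le_iInf fun η => le_iInf fun hξ => le_iInf fun hη => ?_
    refine (iInf_le _ (squareSummableMk ξ hξ, squareSummableMk η hη)).trans (le_of_eq ?_)
    congr 1
  suffices ∀ g ∈ Submodule.span ℂ (Set.range f), ∃ ξ η : SquareSummable H,
      g = (M.vectorFunctional ξ η).1.toLinearMap by
    obtain ⟨ξ, η, h⟩ := this _ hspan
    exact ⟨ξ, η, predual_ext fun x => LinearMap.congr_fun h x⟩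
  intro g hg
  induction hg using Submodule.span_induction with
  | mem g hg =>
    obtain ⟨p, rfl⟩ := hg
    exact ⟨p.1, p.2, rfl⟩
  | zero => exact ⟨0, 0, by ext x; simp⟩
  | add g g' _ _ h h' =>
    obtain ⟨ξ, η, rfl⟩ := h
    obtain ⟨ξ', η', rfl⟩ := h'
    refine ⟨interleave ξ ξ', interleave η η', ?_⟩
    ext x
    simp [amplification_interleave, inner_interleave]
  | smul c g _ h =>
    obtain ⟨ξ, η, rfl⟩ := h
    refine ⟨ξ, c • η, ?_⟩
    ext x
    simp

theorem star_mul_self_mem_positiveCone (x : M.toStarSubalgebra) :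
    star x * x ∈ M.positiveCone :=
  ContinuousLinearMap.isPositive_adjoint_comp_self (x : H →L[ℂ] H)

/-- A normal functional that is positive is self-adjoint. -/
theorem predualPositiveCone_subset_predualSelfAdjoint :
    M.predualPositiveCone ⊆ M.predualSelfAdjoint := by
  intro ω hω x
  have him : ∀ y : M.toStarSubalgebra, (ω.1 (star y * y)).im = 0 := fun y =>
    (Complex.le_def.1 (hω _ (star_mul_self_mem_positiveCone y))).2.symm
  have h0 := him x
  have h1 := him 1
  have h2 := him (x + 1)
  -- `x + 1` relates the imaginary parts of `ω x` and `ω (star x)`, and `x + I` the real parts.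
  have h3 := him (x + Complex.I • (1 : M.toStarSubalgebra))
  simp only [star_add, star_one, add_mul, mul_add, one_mul, mul_one, map_add, star_smul,
    smul_mul_assoc, mul_smul_comm, map_smul, smul_eq_mul, Complex.add_im, Complex.mul_im,
    Complex.mul_re, Complex.I_re, Complex.I_im, Complex.star_def, Complex.conj_re,
    Complex.conj_im] at h1 h2 h3
  apply Complex.ext
  · simp only [Complex.star_def, Complex.conj_re]
    linarith
  · simp only [Complex.star_def, Complex.conj_im]
    linarith

/-- The density of a positive normal functional dominated by a vector functional. -/
theorem exists_density_of_le_vectorFunctional {φ : M.predual} (hφ : φ ∈ M.predualPositiveCone)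
    {ξ : SquareSummable H}
    (hle : ∀ x ∈ M.positiveCone, (φ.1 x).re ≤ ((M.vectorFunctional ξ ξ).1 x).re) :
    ∃ h : SquareSummable H →L[ℂ] SquareSummable H, 0 ≤ h ∧ h ≤ 1 ∧
      (∀ x : M.toStarSubalgebra, Commute h (amplification H x)) ∧
      φ = M.vectorFunctional ξ (h ξ) := by
  obtain ⟨h, h0, h1, hc, hh⟩ := exists_commutant_density
    ((amplification H).comp M.toStarSubalgebra.subtype) ξ (φ := φ.1.toLinearMap)
    (fun x => hφ _ (star_mul_self_mem_positiveCone x))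
    (fun x => predualPositiveCone_subset_predualSelfAdjoint hφ x) fun x => by
      refine (hle _ (star_mul_self_mem_positiveCone x)).trans (le_of_eq ?_)
      rw [vectorFunctional_apply, ← inner_self_eq_norm_sq (𝕜 := ℂ)]
      have : amplification H ((star x * x : M.toStarSubalgebra) : H →L[ℂ] H) =
          star (amplification H (x : H →L[ℂ] H)) * amplification H (x : H →L[ℂ] H) := by
        rw [← map_star, ← map_mul]
        rfl
      rw [this, mul_apply_eq_comp, ContinuousLinearMap.star_eq_adjoint,
        ContinuousLinearMap.adjoint_inner_right]
      rfl
  exact ⟨h, h0, h1, hc, predual_ext hh⟩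

/-- A functional with a positive contractive density `h` in the commutant is the vector functional
of a square root of `h`. -/
theorem exists_vectorFunctional_eq_sqrt {h : SquareSummable H →L[ℂ] SquareSummable H} (h0 : 0 ≤ h)
    (h1 : h ≤ 1) (hc : ∀ x : M.toStarSubalgebra, Commute h (amplification H x)) :
    ∃ r : SquareSummable H →L[ℂ] SquareSummable H, ‖r‖ ≤ 1 ∧
      ∀ ξ, M.vectorFunctional ξ (h ξ) = M.vectorFunctional (r ξ) (r ξ) := by
  obtain ⟨r, hr, hrc, hrr⟩ := exists_sqrt_of_contraction h0 h1
  refine ⟨r, hr, fun ξ => predual_ext fun x => ?_⟩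
  rw [vectorFunctional_apply, vectorFunctional_apply, ← mul_apply_eq_comp, ← (hc x).eq,
    mul_apply_eq_comp, hrr, ← mul_apply_eq_comp r, (hrc _ (hc x)).eq, mul_apply_eq_comp]

/-- Polarization: the real part of a vector functional is dominated on positive elements. -/
theorem re_vectorFunctional_le (ξ η : SquareSummable H) {x : M.toStarSubalgebra}
    (hx : x ∈ M.positiveCone) :
    2 * ((M.vectorFunctional ξ η).1 x).re ≤
      ((M.vectorFunctional ξ ξ).1 x).re + ((M.vectorFunctional η η).1 x).re := by
  have h := (Complex.le_def.1 (vectorFunctional_mem_predualPositiveCone (M := M) (ξ - η) x hx)).1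
  have hs : ⟪η, amplification H x ξ⟫_ℂ = star ⟪ξ, amplification H x η⟫_ℂ := by
    rw [← ((ContinuousLinearMap.nonneg_iff_isPositive _).1
      (amplification_nonneg hx)).inner_left_eq_inner_right]
    exact (inner_conj_symm _ _).symm
  rw [vectorFunctional_apply, map_sub, inner_sub_left, inner_sub_right, inner_sub_right, hs] at h
  simp only [Complex.sub_re, Complex.star_def, Complex.conj_re, Complex.zero_re] at h
  simp only [vectorFunctional_apply]
  linarith

/-- Every positive normal functional is `x ↦ ∑ₙ ⟪ξₙ, x ξₙ⟫` for some `ξ`. -/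
theorem exists_eq_vectorFunctional_self {φ : M.predual} (hφ : φ ∈ M.predualPositiveCone) :
    ∃ ξ : SquareSummable H, φ = M.vectorFunctional ξ ξ := by
  obtain ⟨ξ, η, rfl⟩ := exists_eq_vectorFunctional φ
  -- Polarization gives `2φ ≤ ω_ξ + ω_η`, and `φ ≥ 0`, so `φ` lies below the vector functional of
  -- `interleave ξ η`.
  obtain ⟨h, h0, h1, hc, hh⟩ := exists_density_of_le_vectorFunctional hφ (ξ := interleave ξ η)
    fun x hx => by
      have h1 := re_vectorFunctional_le ξ η hx
      have h2 := (Complex.le_def.1 (hφ x hx)).1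
      simp only [vectorFunctional_apply, Complex.zero_re, amplification_interleave,
        inner_interleave, Complex.add_re] at h1 h2 ⊢
      linarith
  obtain ⟨r, -, hr⟩ := exists_vectorFunctional_eq_sqrt h0 h1 hc
  exact ⟨_, hh.trans (hr _)⟩

/-! ### Norm estimates and approximate decomposition below a sum. -/

theorem norm_vectorFunctional_le (ξ η : SquareSummable H) :
    ‖M.vectorFunctional ξ η‖ ≤ ‖ξ‖ * ‖η‖ := by
  change ‖(M.vectorFunctional ξ η).1‖ ≤ _
  exact ContinuousLinearMap.opNorm_le_bound _ (by positivity) fun x =>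
    norm_inner_amplification_le ξ η x

theorem vectorFunctional_one (ξ η : SquareSummable H) :
    (M.vectorFunctional ξ η).1 1 = ⟪ξ, η⟫_ℂ := by
  rw [vectorFunctional_apply]
  simp

theorem vectorFunctional_sub_left (ξ ξ' η : SquareSummable H) :
    M.vectorFunctional (ξ - ξ') η = M.vectorFunctional ξ η - M.vectorFunctional ξ' η :=
  predual_ext fun x => inner_sub_left ξ ξ' (amplification H x η)

theorem vectorFunctional_sub_right (ξ η η' : SquareSummable H) :
    M.vectorFunctional ξ (η - η') = M.vectorFunctional ξ η - M.vectorFunctional ξ η' := by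
  refine predual_ext fun x => ?_
  rw [vectorFunctional_apply, map_sub]
  exact inner_sub_right ξ (amplification H x η) (amplification H x η')

theorem vectorFunctional_zero_right (ξ : SquareSummable H) : M.vectorFunctional ξ 0 = 0 :=
  predual_ext fun x => by
    rw [vectorFunctional_apply, map_zero, inner_zero_right]
    rfl

theorem vectorFunctional_interleave_zero (ξ η : SquareSummable H) :
    M.vectorFunctional (interleave ξ 0) (interleave η 0) = M.vectorFunctional ξ η := by
  refine predual_ext fun x => ?_
  rw [vectorFunctional_apply, amplification_interleave, inner_interleave, inner_zero_left, add_zero]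
  rfl

/-- The bound involves only `‖ξ‖` and the distance. This keeps the later error independent of
`a(1)`, which need not be bounded on `F`. -/
theorem norm_vectorFunctional_sub_le (ξ η : SquareSummable H) :
    ‖M.vectorFunctional ξ ξ - M.vectorFunctional η η‖ ≤ (2 * ‖ξ‖ + ‖ξ - η‖) * ‖ξ - η‖ := by
  have h : M.vectorFunctional ξ ξ - M.vectorFunctional η η =
      M.vectorFunctional (ξ - η) ξ + M.vectorFunctional η (ξ - η) := by
    rw [vectorFunctional_sub_left, vectorFunctional_sub_right]
    abel
  have h2 : ‖η‖ ≤ ‖ξ‖ + ‖ξ - η‖ := by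
    rw [norm_sub_rev]
    exact norm_le_norm_add_norm_sub' η ξ
  rw [h]
  refine (norm_add_le (M.vectorFunctional (ξ - η) ξ) _).trans
    ((add_le_add (norm_vectorFunctional_le _ _) (norm_vectorFunctional_le _ _)).trans ?_)
  nlinarith [norm_nonneg (ξ - η)]

set_option maxHeartbeats 800000 in
/-- If `φ ≤ a + b` for positive normal functionals, then `φ` is approximated by a positive normal
functional below `a`, up to an error controlled by `φ(1)` and `b(1)` alone. -/
theorem exists_le_norm_sub_le {φ a b : M.predual} (hφ : φ ∈ M.predualPositiveCone)
    (ha : a ∈ M.predualPositiveCone) (hb : b ∈ M.predualPositiveCone)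
    (hle : ∀ x ∈ M.positiveCone, (φ.1 x).re ≤ (a.1 x).re + (b.1 x).re) :
    ∃ ψ ∈ M.predualPositiveCone, a - ψ ∈ M.predualPositiveCone ∧
      ‖φ - ψ‖ ≤ (2 * √(φ.1 1).re + √(b.1 1).re) * √(b.1 1).re := by
  obtain ⟨ξ, rfl⟩ := exists_eq_vectorFunctional_self ha
  obtain ⟨η, rfl⟩ := exists_eq_vectorFunctional_self hb
  obtain ⟨h, h0, h1, hc, hh⟩ := exists_density_of_le_vectorFunctional hφ (ξ := interleave ξ η)
    fun x hx => by
      refine (hle x hx).trans (le_of_eq ?_)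
      rw [vectorFunctional_apply _ _ x, vectorFunctional_apply _ _ x, vectorFunctional_apply _ _ x,
        amplification_interleave, inner_interleave, Complex.add_re]
  have hnorm : ∀ v : SquareSummable H, √((M.vectorFunctional v v).1 1).re = ‖v‖ := fun v => by
    rw [vectorFunctional_one, ← Real.sqrt_sq (norm_nonneg v), ← inner_self_eq_norm_sq (𝕜 := ℂ)]
    rfl
  obtain ⟨r, hr, hcs⟩ := exists_vectorFunctional_eq_sqrt h0 h1 hc
  rw [hcs] at hh
  -- The density of `φ` applied to the `a`-part alone; `a - ψ` then has the positive density `1 -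
  -- h`.
  refine ⟨M.vectorFunctional (interleave ξ 0) (h (interleave ξ 0)), ?_, ?_, ?_⟩
  · rw [hcs]
    exact vectorFunctional_mem_predualPositiveCone _
  · obtain ⟨h', h0', h1', hc', hh'⟩ := exists_compl_of_contraction h0 h1
    obtain ⟨s, -, hs⟩ := exists_vectorFunctional_eq_sqrt (M := M) h0' h1' fun x => hc' _ (hc x)
    have h3 := hs (interleave ξ 0)
    rw [hh', vectorFunctional_sub_right] at h3
    rw [← vectorFunctional_interleave_zero ξ ξ, h3]
    exact vectorFunctional_mem_predualPositiveCone _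
  · have h3 : ‖interleave ξ η - interleave ξ 0‖ = ‖η‖ := by
      rw [interleave_sub, sub_self, sub_zero, ← sq_eq_sq₀ (norm_nonneg _) (norm_nonneg _),
        norm_interleave_sq]
      simp
    have h4 : ‖r (interleave ξ η) - r (interleave ξ 0)‖ ≤ ‖η‖ := by
      rw [← map_sub, ← h3]
      exact (r.le_of_opNorm_le hr _).trans_eq (one_mul _)
    have h5 : √(φ.1 1).re = ‖r (interleave ξ η)‖ := by rw [hh, hnorm]
    rw [hnorm, h5, hcs, hh]
    exact (norm_vectorFunctional_sub_le _ _).trans (by gcongr)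

/-! ### Hahn-Banach separation and bounded sesquilinear forms. -/

section LinearFunctionals

/-- Separation of a point from a convex set that absorbs every vector. -/
theorem exists_linear_separation {E : Type*} [AddCommGroup E] [Module ℝ E] {s : Set E}
    (hs : Convex ℝ s) (habs : ∀ x : E, ∃ ε > 0, ∀ t : ℝ, |t| < ε → t • x ∈ s) {x₀ : E}
    (hx₀ : x₀ ∉ s) : ∃ f : E →ₗ[ℝ] ℝ, f x₀ = 1 ∧ ∀ x ∈ s, f x ≤ 1 := by
  have h0 : (0 : E) ∈ s := by
    obtain ⟨ε, hε, h⟩ := habs 0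
    simpa using h 0 (by simpa using hε)
  have habs' : Absorbent ℝ s := by
    rw [absorbent_iff_inv_smul]
    intro x
    obtain ⟨ε, hε, h⟩ := habs x
    have ht := (Filter.tendsto_inv₀_cobounded (α := ℝ)).eventually (Metric.ball_mem_nhds 0 hε)
    filter_upwards [ht] with c hc
    exact h _ (by simpa using hc)
  let f : E →ₗ.[ℝ] ℝ := LinearPMap.mkSpanSingleton x₀ 1 (ne_of_mem_of_not_mem h0 hx₀).symm
  -- Hahn-Banach with the gauge of `s` as sublinear majorant; absorption replaces any topology on
  -- `E`, and `x₀ ∉ s` gives gauge at least `1` at `x₀`.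
  obtain ⟨g, hg, hg'⟩ := exists_extension_of_le_sublinear f (gauge s)
    (fun c hc => gauge_smul_of_nonneg hc.le) (gauge_add_le hs habs') (by
      rintro ⟨x, hx⟩
      obtain ⟨y, rfl⟩ := Submodule.mem_span_singleton.1 hx
      rw [LinearPMap.mkSpanSingleton'_apply]
      simp only [mul_one, smul_eq_mul]
      obtain h | h := le_or_gt y 0
      · exact h.trans (gauge_nonneg _)
      · rw [gauge_smul_of_nonneg h.le, smul_eq_mul, RingHom.id_apply, le_mul_iff_one_le_right h]
        exact one_le_gauge_of_notMem (hs.starConvex h0) habs'.absorbs hx₀)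
  refine ⟨g, ?_, fun x hx => (hg' x).trans (gauge_le_one_of_mem hx)⟩
  exact (hg ⟨x₀, Submodule.mem_span_singleton_self _⟩).trans
    (LinearPMap.mkSpanSingleton'_apply_self _ _ _ _)

/-- A real functional that is bounded on the range of a sesquilinear map is represented there by a
bounded operator. -/
theorem exists_operator_of_le {K E : Type*} [NormedAddCommGroup K] [InnerProductSpace ℂ K]
    [CompleteSpace K] [AddCommGroup E] [Module ℂ E] [Module ℝ E] [IsScalarTower ℝ ℂ E]
    (v : K →ₗ⋆[ℂ] K →ₗ[ℂ] E) (f : E →ₗ[ℝ] ℝ) (C : ℝ)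
    (hf : ∀ ξ η, f (v ξ η) ≤ C * (‖ξ‖ ^ 2 + ‖η‖ ^ 2)) :
    ∃ X : K →L[ℂ] K, ∀ ξ η, f (v ξ η) = (⟪ξ, X η⟫_ℂ).re ∧
      ∀ ξ' η', v ξ η = v ξ' η' → ⟪ξ, X η⟫_ℂ = ⟪ξ', X η'⟫_ℂ := by
  let g : Module.Dual ℂ E := Module.Dual.extendRCLike f
  have hre : ∀ ω, (g ω).re = f ω := fun ω =>
    Module.Dual.re_extendRCLike_apply (𝕜 := ℂ) f ω
  have him : ∀ ω, (g ω).im = -f (Complex.I • ω) := fun ω =>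
    Module.Dual.im_extendRCLike_apply (𝕜 := ℂ) f ω
  have habs : ∀ ξ η, |f (v ξ η)| ≤ C * (‖ξ‖ ^ 2 + ‖η‖ ^ 2) := fun ξ η => by
    refine abs_le'.2 ⟨hf ξ η, ?_⟩
    have h := hf ξ (-η)
    rwa [map_neg, map_neg, norm_neg] at h
  have hg : ∀ ξ η, ‖g (v ξ η)‖ ≤ 2 * C * (‖ξ‖ ^ 2 + ‖η‖ ^ 2) := fun ξ η => by
    refine (Complex.norm_le_abs_re_add_abs_im _).trans ?_
    have h := habs ξ (Complex.I • η)
    rw [map_smul, norm_smul, Complex.norm_I, one_mul] at h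
    rw [hre, him, abs_neg]
    linarith [habs ξ η]
  -- Scaling both arguments to unit vectors turns the sum of squares into a product, with `4C = 2C(1
  -- + 1)`.
  have hg' : ∀ ξ η, ‖(v.compr₂ₛₗ g) ξ η‖ ≤ 4 * C * ‖ξ‖ * ‖η‖ := fun ξ η => by
    change ‖g (v ξ η)‖ ≤ _
    rcases eq_or_ne ξ 0 with rfl | hξ
    · simp
    rcases eq_or_ne η 0 with rfl | hη
    · simp
    have hξ' : (‖ξ‖ : ℂ) ≠ 0 := by simpa using hξ
    have hη' : (‖η‖ : ℂ) ≠ 0 := by simpa using hη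
    have h := hg ((‖ξ‖ : ℂ)⁻¹ • ξ) ((‖η‖ : ℂ)⁻¹ • η)
    have e1 : ‖(‖ξ‖ : ℂ)⁻¹ • ξ‖ = 1 := norm_smul_inv_norm hξ
    have e2 : ‖(‖η‖ : ℂ)⁻¹ • η‖ = 1 := norm_smul_inv_norm hη
    have e3 : v ξ η = (‖ξ‖ : ℂ) • (‖η‖ : ℂ) • v ((‖ξ‖ : ℂ)⁻¹ • ξ) ((‖η‖ : ℂ)⁻¹ • η) := by
      rw [map_smul, LinearMap.map_smulₛₗ₂, map_inv₀, Complex.conj_ofReal,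
        smul_inv_smul₀ hη', smul_inv_smul₀ hξ']
    rw [e1, e2] at h
    rw [e3, map_smul, map_smul, norm_smul, norm_smul, Complex.norm_real, Complex.norm_real,
      norm_norm, norm_norm]
    calc ‖ξ‖ * (‖η‖ * _) ≤ ‖ξ‖ * (‖η‖ * (2 * C * (1 ^ 2 + 1 ^ 2))) := by gcongr
      _ = 4 * C * ‖ξ‖ * ‖η‖ := by ring
  let B : K →L⋆[ℂ] K →L[ℂ] ℂ := (v.compr₂ₛₗ g).mkContinuous₂ (4 * C) hg'
  let X := ContinuousLinearMap.adjoint (InnerProductSpace.continuousLinearMapOfBilin B)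
  have hX : ∀ ξ η, ⟪ξ, X η⟫_ℂ = g (v ξ η) := fun ξ η => by
    rw [ContinuousLinearMap.adjoint_inner_right,
      InnerProductSpace.continuousLinearMapOfBilin_apply]
    rfl
  exact ⟨X, fun ξ η => ⟨by rw [hX, hre], fun ξ' η' h => by rw [hX, hX, h]⟩⟩

end LinearFunctionals

/-! ### Monotone functionals on the predual as evaluations at elements of `M`. -/

/-- `vectorFunctional` as a sesquilinear map. -/
noncomputable def vectorFunctionalₗ (M : VonNeumannAlgebra H) :
    SquareSummable H →ₗ⋆[ℂ] SquareSummable H →ₗ[ℂ] M.predual :=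
  LinearMap.mk₂'ₛₗ _ _ M.vectorFunctional
    (fun ξ ξ' η => predual_ext fun x => inner_add_left ξ ξ' (amplification H x η))
    (fun c ξ η => predual_ext fun x => inner_smul_left ξ (amplification H x η) c)
    (fun ξ η η' => predual_ext fun x => by
      rw [vectorFunctional_apply, map_add]
      exact inner_add_right ξ (amplification H x η) (amplification H x η'))
    (fun c ξ η => predual_ext fun x => by
      rw [vectorFunctional_apply, map_smul]
      exact inner_smul_right ξ (amplification H x η) c)

/-- Supplies a positive majorant for every normal functional, whence both absorption by
`dominatedSet` and boundedness of the separating functional. -/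
theorem re_vectorFunctional_le_interleave (ξ η : SquareSummable H) {x : M.toStarSubalgebra}
    (hx : x ∈ M.positiveCone) : ((M.vectorFunctional ξ η).1 x).re ≤
      ((M.vectorFunctional (interleave ξ η) (interleave ξ η)).1 x).re := by
  have h1 := re_vectorFunctional_le ξ η hx
  have h2 := (Complex.le_def.1 (vectorFunctional_mem_predualPositiveCone ξ x hx)).1
  have h3 := (Complex.le_def.1 (vectorFunctional_mem_predualPositiveCone η x hx)).1
  simp only [vectorFunctional_apply, Complex.zero_re, amplification_interleave,
    inner_interleave, Complex.add_re] at h1 h2 h3 ⊢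
  linarith

theorem amplification_single (x : H →L[ℂ] H) (n : ℕ) (u : H) :
    amplification H x (lp.single 2 n u) = lp.single 2 n (x u) := by
  ext m
  rw [amplification_apply, lp.single_apply, lp.single_apply]
  rcases eq_or_ne m n with rfl | hm
  · simp
  · simp [hm]

/-- Amplified operators act alike in every coordinate, so a single coordinate can be moved to `0`.
This forces the representing operator to be an amplification. -/
theorem vectorFunctional_single (ξ : SquareSummable H) (n : ℕ) (u : H) :
    M.vectorFunctional ξ (lp.single 2 n u) =
      M.vectorFunctional (lp.single 2 0 (ξ n)) (lp.single 2 0 u) := by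
  refine predual_ext fun x => ?_
  rw [vectorFunctional_apply, vectorFunctional_apply, amplification_single,
    amplification_single, lp.inner_single_right, lp.inner_single_right, lp.single_apply_self]

theorem vectorFunctional_single_single (u w : H) (m : M.toStarSubalgebra) :
    (M.vectorFunctional (lp.single 2 0 u) (lp.single 2 0 w)).1 m =
      ⟪u, (m : H →L[ℂ] H) w⟫_ℂ := by
  rw [vectorFunctional_apply, amplification_single, lp.inner_single_right, lp.single_apply_self]

/-- A real functional on the predual that is suitably bounded on vector functionals is the
real part of the evaluation at an element of `M`. -/
theorem exists_eq_re_of_le (f : M.predual →ₗ[ℝ] ℝ) (C : ℝ)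
    (hf : ∀ ξ η, f (M.vectorFunctional ξ η) ≤ C * (‖ξ‖ ^ 2 + ‖η‖ ^ 2)) :
    ∃ x : M.toStarSubalgebra, ∀ ω : M.predual, f ω = (ω.1 x).re := by
  obtain ⟨X, hX⟩ := exists_operator_of_le (K := SquareSummable H) (E := M.predual)
    M.vectorFunctionalₗ f C hf
  have hXf : ∀ ξ η, f (M.vectorFunctional ξ η) = (⟪ξ, X η⟫_ℂ).re := fun ξ η => (hX ξ η).1
  -- The form of `X` depends only on the functional, so every identity between vector functionals on
  -- `M` becomes an identity for `X`.
  have hXe : ∀ {ξ η ξ' η'}, M.vectorFunctional ξ η = M.vectorFunctional ξ' η' →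
    ⟪ξ, X η⟫_ℂ = ⟪ξ', X η'⟫_ℂ := fun h => (hX _ _).2 _ _ h
  let e : H →L[ℂ] SquareSummable H := lp.singleContinuousLinearMap ℂ (fun _ : ℕ => H) 2 0
  let x : H →L[ℂ] H := ContinuousLinearMap.adjoint e ∘L X ∘L e
  have hx : ∀ u w, ⟪u, x w⟫_ℂ = ⟪e u, X (e w)⟫_ℂ := fun u w =>
    ContinuousLinearMap.adjoint_inner_right e u (X (e w))
  have hev : ∀ (m : M.toStarSubalgebra) u w,
      (M.vectorFunctional (e u) (e w)).1 m = ⟪u, (m : H →L[ℂ] H) w⟫_ℂ := fun m u w =>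
    vectorFunctional_single_single u w m
  -- For `y` in the commutant, the pairs `(y* u, w)` and `(u, y w)` induce the same functional on
  -- `M`; hence `x` commutes with `y`.
  have hxM : x ∈ M := by
    rw [← commutant_commutant M, mem_commutant_iff]
    intro y hy
    rw [mem_commutant_iff] at hy
    ext w
    refine ext_inner_left ℂ fun u => ?_
    rw [mul_apply_eq_comp, mul_apply_eq_comp, ← ContinuousLinearMap.adjoint_inner_left, hx, hx]
    refine hXe (predual_ext fun m => ?_)
    rw [hev, hev, ContinuousLinearMap.adjoint_inner_left, ← mul_apply_eq_comp,
      ← mul_apply_eq_comp, hy m m.2]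
  have hXx : X = amplification H x := by
    refine lp.ext_continuousLinearMap (by norm_num) fun n => ?_
    ext1 w
    refine ext_inner_left ℂ fun ξ => ?_
    change ⟪ξ, X (lp.single 2 n w)⟫_ℂ = ⟪ξ, amplification H x (lp.single 2 n w)⟫_ℂ
    rw [hXe (vectorFunctional_single ξ n w), amplification_single, lp.inner_single_right, hx]
    rfl
  refine ⟨⟨x, hxM⟩, fun ω => ?_⟩
  obtain ⟨ξ, η, rfl⟩ := exists_eq_vectorFunctional ω
  rw [hXf, hXx]
  rfl

/-- An element of `M` is positive if every normal functional with nonnegative real part on `M⁺` has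
nonnegative real part there. -/
theorem mem_positiveCone_of_re {x : M.toStarSubalgebra}
    (h : ∀ ω : M.predual, (∀ y ∈ M.positiveCone, 0 ≤ (ω.1 y).re) → 0 ≤ (ω.1 x).re) :
    x ∈ M.positiveCone := by
  change (x : H →L[ℂ] H).IsPositive
  rw [ContinuousLinearMap.isPositive_iff_complex]
  intro u
  have hpos : ∀ y ∈ M.positiveCone, 0 ≤ ⟪u, (y : H →L[ℂ] H) u⟫_ℂ := fun y hy =>
    hy.inner_nonneg_right u
  have h1 : 0 ≤ (⟪u, (x : H →L[ℂ] H) u⟫_ℂ).re := by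
    rw [← vectorFunctional_single_single]
    refine h _ fun y hy => ?_
    rw [vectorFunctional_single_single]
    exact (Complex.le_def.1 (hpos y hy)).1
  -- An imaginary multiple of a positive functional has zero real part on `M⁺`; using both signs
  -- makes `⟪u, x u⟫` real.
  have h2 : ∀ c : ℂ, c.re = 0 → 0 ≤ (c * ⟪u, (x : H →L[ℂ] H) u⟫_ℂ).re := fun c hc => by
    rw [← inner_smul_right, ← map_smul, ← vectorFunctional_single_single]
    refine h _ fun y hy => ?_
    rw [vectorFunctional_single_single, map_smul, inner_smul_right, Complex.mul_re, hc,
      ← (Complex.le_def.1 (hpos y hy)).2]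
    simp
  have h3 := h2 Complex.I Complex.I_re
  have h4 := h2 (-Complex.I) (by simp)
  simp only [neg_mul, Complex.neg_re, Complex.I_mul_re] at h3 h4
  have h5 : ⟪(x : H →L[ℂ] H) u, u⟫_ℂ = star ⟪u, (x : H →L[ℂ] H) u⟫_ℂ :=
    (inner_conj_symm _ _).symm
  rw [h5]
  refine ⟨Complex.ext rfl ?_, h1⟩
  simp only [Complex.star_def, RCLike.re_to_complex, Complex.ofReal_im, Complex.conj_im]
  linarith

/-- A real functional on the predual that is monotone and dominated by a multiple of `b ↦ b(1)` on
positive functionals is the evaluation at a positive element of `M`. -/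
theorem exists_mem_positiveCone_eq_re (f : M.predual →ₗ[ℝ] ℝ)
    (hmono : ∀ φ ψ : M.predual, (∀ x ∈ M.positiveCone, (φ.1 x).re ≤ (ψ.1 x).re) → f φ ≤ f ψ)
    (C : ℝ) (hC : ∀ ξ, f (M.vectorFunctional ξ ξ) ≤ C * ‖ξ‖ ^ 2) :
    ∃ x ∈ M.positiveCone, ∀ ω : M.predual, f ω = (ω.1 x).re := by
  obtain ⟨x, hx⟩ := exists_eq_re_of_le f C fun ξ η => by
    rw [← norm_interleave_sq]
    exact (hmono _ _ fun x hx => re_vectorFunctional_le_interleave ξ η hx).trans (hC _)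
  refine ⟨x, mem_positiveCone_of_re fun ω hω => ?_, hx⟩
  rw [← hx, ← map_zero f]
  exact hmono _ _ hω

/-! ### The enlarged set and the separation argument. -/

theorem predual_re_add (φ ψ : M.predual) (x : M.toStarSubalgebra) :
    ((φ + ψ).1 x).re = (φ.1 x).re + (ψ.1 x).re := rfl

theorem predual_re_smul (t : ℝ) (φ : M.predual) (x : M.toStarSubalgebra) :
    ((t • φ).1 x).re = t * (φ.1 x).re := by
  change (t • (φ.1 x)).re = _
  rw [Complex.smul_re, smul_eq_mul]

theorem smul_mem_predualPositiveCone {t : ℝ} (ht : 0 ≤ t) {φ : M.predual}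
    (hφ : φ ∈ M.predualPositiveCone) : t • φ ∈ M.predualPositiveCone := fun x hx =>
  smul_nonneg ht (hφ x hx)

theorem add_mem_predualPositiveCone {φ ψ : M.predual} (hφ : φ ∈ M.predualPositiveCone)
    (hψ : ψ ∈ M.predualPositiveCone) : φ + ψ ∈ M.predualPositiveCone := fun x hx =>
  add_nonneg (hφ x hx) (hψ x hx)

/-- The functionals lying below the sum of an element of `F` and a positive functional of norm at
most `δ`. -/
def dominatedSet (F : Set M.predual) (δ : ℝ) : Set M.predual :=
  {ω | ∃ a ∈ F, ∃ b ∈ M.predualPositiveCone, (b.1 1).re ≤ δ ∧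
    ∀ x ∈ M.positiveCone, (ω.1 x).re ≤ (a.1 x).re + (b.1 x).re}

theorem convex_dominatedSet {F : Set M.predual} (hF : Convex ℝ F) (δ : ℝ) :
    Convex ℝ (dominatedSet F δ) := by
  rintro ω ⟨a, ha, b, hb, hbδ, h⟩ ω' ⟨a', ha', b', hb', hbδ', h'⟩ s t hs ht hst
  refine ⟨s • a + t • a', hF ha ha' hs ht hst, s • b + t • b',
    add_mem_predualPositiveCone (smul_mem_predualPositiveCone hs hb)
      (smul_mem_predualPositiveCone ht hb'), ?_, fun x hx => ?_⟩
  · rw [predual_re_add, predual_re_smul, predual_re_smul]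
    calc s * (b.1 1).re + t * (b'.1 1).re ≤ s * δ + t * δ := by gcongr
      _ = δ := by rw [← add_mul, hst, one_mul]
  · simp only [predual_re_add, predual_re_smul]
    have h1 := mul_le_mul_of_nonneg_left (h x hx) hs
    have h2 := mul_le_mul_of_nonneg_left (h' x hx) ht
    linarith

theorem vectorFunctional_self_one_re (ξ : SquareSummable H) :
    ((M.vectorFunctional ξ ξ).1 1).re = ‖ξ‖ ^ 2 := by
  rw [vectorFunctional_one]
  exact inner_self_eq_norm_sq (𝕜 := ℂ) ξ

theorem exists_smul_mem_dominatedSet {F : Set M.predual} (hne : F.Nonempty)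
    (hF : F ⊆ M.predualPositiveCone) {δ : ℝ} (hδ : 0 < δ) (ω : M.predual) :
    ∃ ε > 0, ∀ t : ℝ, |t| < ε → t • ω ∈ dominatedSet F δ := by
  obtain ⟨ξ, η, rfl⟩ := exists_eq_vectorFunctional ω
  obtain ⟨a, ha⟩ := hne
  set ζ := interleave ξ η
  have hle : ∀ x ∈ M.positiveCone, |((M.vectorFunctional ξ η).1 x).re| ≤
      ((M.vectorFunctional ζ ζ).1 x).re := fun x hx => by
    refine abs_le'.2 ⟨re_vectorFunctional_le_interleave ξ η hx, ?_⟩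
    have h := re_vectorFunctional_le_interleave ξ (-η) hx
    simp only [vectorFunctional_apply, map_neg, inner_neg_right, inner_neg_left, Complex.neg_re,
      amplification_interleave, inner_interleave, neg_neg, ζ] at h ⊢
    exact h
  -- The majorant `|t| ω_ζ` takes the value `|t| ‖ζ‖ ^ 2` at `1`; the `+ 1` avoids division by zero.
  refine ⟨δ / (‖ζ‖ ^ 2 + 1), by positivity, fun t ht => ⟨a, ha, |t| • M.vectorFunctional ζ ζ,
    smul_mem_predualPositiveCone (abs_nonneg t) (vectorFunctional_mem_predualPositiveCone ζ),
    ?_, fun x hx => ?_⟩⟩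
  · rw [predual_re_smul, vectorFunctional_self_one_re]
    have h := (lt_div_iff₀ (by positivity)).1 ht
    nlinarith [abs_nonneg t]
  · rw [predual_re_smul, predual_re_smul]
    have h1 := (Complex.le_def.1 (hF ha x hx)).1
    have h2 : t * ((M.vectorFunctional ξ η).1 x).re ≤
        |t| * ((M.vectorFunctional ζ ζ).1 x).re :=
      (le_abs_self _).trans ((abs_mul _ _).le.trans
        (mul_le_mul_of_nonneg_left (hle x hx) (abs_nonneg t)))
    rw [Complex.zero_re] at h1
    linarith

set_option maxHeartbeats 800000 in
/-- A functional that does not lie below the sum of an element of `F` and a small positive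
functional is separated from `F` by a positive element of `M`. -/
theorem exists_separating_of_notMem_dominatedSet {F : Set M.predual} (hne : F.Nonempty)
    (hF : F ⊆ M.predualPositiveCone) (hconv : Convex ℝ F) {δ : ℝ} (hδ : 0 < δ) {φ : M.predual}
    (hφ : φ ∉ dominatedSet F δ) :
    ∃ x ∈ M.positiveCone, (φ.1 x).re = 1 ∧ ∀ ω ∈ F, (ω.1 x).re ≤ 1 := by
  obtain ⟨f, hf, hfle⟩ := exists_linear_separation (convex_dominatedSet hconv δ)
    (exists_smul_mem_dominatedSet hne hF hδ) hφ
  obtain ⟨a₀, ha₀⟩ := hne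
  have ha₀' : ∀ x ∈ M.positiveCone, 0 ≤ (a₀.1 x).re := fun x hx =>
    (Complex.le_def.1 (hF ha₀ x hx)).1
  have hzero : (0 : M.predual) ∈ M.predualPositiveCone := fun x _ => le_refl (0 : ℂ)
  have hzero_re : ∀ x, ((0 : M.predual).1 x).re = 0 := fun _ => rfl
  -- `dominatedSet` contains the whole cone of functionals with nonpositive real part on `M⁺`, and a
  -- functional bounded above on a cone is nonpositive there.
  have hneg : ∀ ω : M.predual, (∀ x ∈ M.positiveCone, (ω.1 x).re ≤ 0) → f ω ≤ 0 := by
    intro ω hω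
    by_contra! hpos
    have h := hfle ((2 / f ω) • ω) ⟨a₀, ha₀, 0, hzero, hδ.le, fun x hx => by
      rw [predual_re_smul, hzero_re, add_zero]
      exact (mul_nonpos_of_nonneg_of_nonpos (by positivity) (hω x hx)).trans (ha₀' x hx)⟩
    rw [map_smul, smul_eq_mul, div_mul_cancel₀ _ hpos.ne'] at h
    norm_num at h
  obtain ⟨x, hx, hxf⟩ := exists_mem_positiveCone_eq_re f
    (fun φ ψ h => by
      have h1 := hneg (φ + (-1 : ℝ) • ψ) fun x hx => by
        rw [predual_re_add, predual_re_smul]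
        linarith [h x hx]
      rw [map_add, map_smul, smul_eq_mul] at h1
      linarith) (1 / δ) fun ξ => by
      rcases eq_or_ne ξ 0 with rfl | hξ
      · rw [vectorFunctional_zero_right, map_zero]
        simp
      have hξ' : 0 < ‖ξ‖ ^ 2 := by positivity
      -- Scaled to take the value `δ` at `1`, the largest allowed for `b`; this yields the constant
      -- `1 / δ`.
      have h := hfle ((δ / ‖ξ‖ ^ 2) • M.vectorFunctional ξ ξ)
        ⟨a₀, ha₀, (δ / ‖ξ‖ ^ 2) • M.vectorFunctional ξ ξ,
          smul_mem_predualPositiveCone (by positivity) (vectorFunctional_mem_predualPositiveCone ξ),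
          by rw [predual_re_smul, vectorFunctional_self_one_re, div_mul_cancel₀ _ hξ'.ne'],
          fun x hx => by linarith [ha₀' x hx]⟩
      rw [map_smul, smul_eq_mul, div_mul_eq_mul_div, div_le_one hξ'] at h
      rw [one_div, ← div_eq_inv_mul, le_div_iff₀ hδ]
      linarith
  refine ⟨x, hx, by rw [← hxf, hf], fun ω hω => ?_⟩
  rw [← hxf]
  exact hfle ω ⟨ω, hω, 0, hzero, hδ.le, fun x _ => by rw [hzero_re, add_zero]⟩

/-- A positive functional outside a closed hereditary set `F` does not lie below the sum of an
element of `F` and a small positive functional. -/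
theorem exists_notMem_dominatedSet {F : Set M.predual} (hclosed : IsClosed F)
    (hher : M.IsHereditaryInPredual F) {φ : M.predual} (hφ : φ ∈ M.predualPositiveCone)
    (hφF : φ ∉ F) : ∃ δ > 0, φ ∉ dominatedSet F δ := by
  obtain ⟨ε, hε, hball⟩ := Metric.isOpen_iff.1 hclosed.isOpen_compl φ hφF
  -- The error bound tends to zero with `δ`, uniformly in `a ∈ F`.
  have hlim : Filter.Tendsto (fun δ => (2 * √(φ.1 1).re + √δ) * √δ) (𝓝[>] 0) (𝓝 0) := by
    have h : Continuous fun δ => (2 * √(φ.1 1).re + √δ) * √δ := by fun_prop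
    have h0 := h.tendsto 0
    simp only [Real.sqrt_zero, mul_zero] at h0
    exact h0.mono_left nhdsWithin_le_nhds
  obtain ⟨δ, hδε, hδ⟩ := ((hlim.eventually_lt_const hε).and self_mem_nhdsWithin).exists
  refine ⟨δ, hδ, ?_⟩
  rintro ⟨a, ha, b, hb, hbδ, hle⟩
  obtain ⟨ψ, hψ, haψ, hnorm⟩ := exists_le_norm_sub_le hφ (hher.1 ha) hb hle
  refine hball ?_ (hher.2 ψ a hψ haψ ha)
  have hdist : dist φ ψ = ‖φ - ψ‖ := dist_eq_norm φ.1 ψ.1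
  rw [Metric.mem_ball, dist_comm, hdist]
  refine hnorm.trans_lt (lt_of_le_of_lt ?_ hδε)
  have := Real.sqrt_le_sqrt hbδ
  gcongr

/-- A positive functional outside a closed convex hereditary set `F` is strictly separated from `F`
by a positive element of `M`. -/
theorem exists_separating_of_notMem {F : Set M.predual} (hne : F.Nonempty) (hclosed : IsClosed F)
    (hconv : Convex ℝ F) (hher : M.IsHereditaryInPredual F) {φ : M.predual}
    (hφ : φ ∈ M.predualPositiveCone) (hφF : φ ∉ F) :
    ∃ x ∈ M.positiveCone, 1 < (φ.1 x).re ∧ ∀ ω ∈ F, (ω.1 x).re ≤ 1 := by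
  have hlim : Filter.Tendsto (fun c : ℝ => c • φ) (𝓝[<] 1) (𝓝 φ) := by
    have h : Continuous fun c : ℝ => c • φ := by
      have h' : Continuous fun c : ℝ => (c : ℂ) • φ :=
        Complex.continuous_ofReal.smul continuous_const
      convert! h' using 2
    have h1 := h.tendsto 1
    rw [one_smul] at h1
    exact h1.mono_left nhdsWithin_le_nhds
  -- Separation gives only the value `1`, so it is applied to `c • φ ∉ F` with `0 < c < 1`; then `φ`
  -- takes the value `1 / c > 1`.
  obtain ⟨c, ⟨hcF, hc0⟩, hc1⟩ := ((hlim.eventually (hclosed.isOpen_compl.mem_nhds hφF)).and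
    (nhdsWithin_le_nhds (lt_mem_nhds zero_lt_one))).and self_mem_nhdsWithin |>.exists
  obtain ⟨δ, hδ, hcδ⟩ := exists_notMem_dominatedSet hclosed hher
    (smul_mem_predualPositiveCone hc0.le hφ) hcF
  obtain ⟨x, hx, hx1, hxF⟩ :=
    exists_separating_of_notMem_dominatedSet hne hher.1 hconv hδ hcδ
  refine ⟨x, hx, ?_, hxF⟩
  rw [predual_re_smul] at hx1
  have hc1' : c < 1 := hc1
  nlinarith

end VonNeumannAlgebra

theorem theorem3p2 {H : Type*} [NormedAddCommGroup H] [InnerProductSpace ℂ H] [CompleteSpace H]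
    (M : VonNeumannAlgebra H) (F : Set M.predual) (hne : F.Nonempty)
    (hclosed : IsClosed F) (hconv : Convex ℝ F) (hher : M.IsHereditaryInPredual F) :
    F = M.predualPositivePolar (M.positivePolar F) ∧
      ∀ ω' ∈ M.predualPositiveCone \ F, ∃ x ∈ M.positiveCone,
        1 < (ω'.1 x).re ∧ ∀ ω ∈ F, (ω.1 x).re ≤ 1 := by
  have hsep : ∀ ω' ∈ M.predualPositiveCone \ F, ∃ x ∈ M.positiveCone,
      1 < (ω'.1 x).re ∧ ∀ ω ∈ F, (ω.1 x).re ≤ 1 := fun ω' hω' =>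
    VonNeumannAlgebra.exists_separating_of_notMem hne hclosed hconv hher hω'.1 hω'.2
  refine ⟨Set.Subset.antisymm (fun ω hω => ?_) fun ω hω => ?_, hsep⟩
  · exact ⟨⟨VonNeumannAlgebra.predualPositiveCone_subset_predualSelfAdjoint (hher.1 hω),
      fun x hx => hx.1.2 ω hω⟩, hher.1 hω⟩
  · by_contra hωF
    obtain ⟨x, hx, hx1, hxF⟩ := hsep ω ⟨hω.2, hωF⟩
    have hxsa : IsSelfAdjoint x := Subtype.ext <|
      (show (x : H →L[ℂ] H).IsPositive from hx).isSelfAdjoint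
    exact hx1.not_ge (hω.1.2 x ⟨⟨hxsa, hxF⟩, hx⟩)
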